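/- Let $\mathcal H$ be a separable complex Hilbert space, let $\mathbf T=(T_1,\dots,T_d)$ be a $d$-tuple of bounded linear operators on $\mathcal H$ (not assumed to commute), and let $t\in[0,1]$. Write $$\|\mathbf T\|=\sup\Big\{\Big(\sum_{k=1}^d\|T_kx\|^2\Big)^{1/2}:\ x\in\mathcal H,\ \|x\|=1\Big\}$$ for the spherical norm (with value $0$ if $\mathcal H=\{0\}$), $P=(T_1^*T_1+\cdots+T_d^*T_d)^{1/2}$, and let $\mathbf T=\mathbf VP=(V_1P,\dots,V_dP)$ be the canonical spherical polar decomposition, i.e. $\mathbf V=(V_1,\dots,V_d)$ is the unique tuple of bounded operators such that $T_i=V_iP$ for all $i$ and $\sum_{i=1}^d V_i^*V_i$ is the orthogonal projection onto $\big(\bigcap_{i=1}^d\ker T_i\big)^\perp$. With $P^0=I$, define the spherical Aluthge, Duggal and Heinz transforms by $$\widetilde{\mathbf T}=(P^{1/2}V_iP^{1/2})_{i=1}^d,\qquad \mathbf T^D=(PV_i)_{i=1}^d,\qquad \widehat{\mathbf T}(t)=\Big(\tfrac12\big(P^tV_iP^{1-t}+P^{1-t}V_iP^t\big)\Big)_{i=1}^d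 .$$ Then (with $0^0=1$) $$\|\widetilde{\mathbf T}\|\le\|\widehat{\mathbf T}(t)\|\le\tfrac12\Big(\|\mathbf T^D\|^{t}\|\mathbf T\|^{1-t}+\|\mathbf T^D\|^{1-t}\|\mathbf T\|^{t}\Big)\le\|\mathbf T\| .$$ In particular, $$\|\widetilde{\mathbf T}\|\le\|\widehat{\mathbf T}(t)\|\le\tfrac12\big(\|\mathbf T^D\|+\|\mathbf T\|\big)\le\|\mathbf T\| .$$ -/

import Mathlib

namespace SphericalTransforms

open scoped InnerProductSpace

noncomputable section

/-- The spherical (joint) operator norm `sup {(∑ ‖T k x‖²)^(1/2) : ‖x‖ = 1}` of an operator tuple.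
For the zero space the supremum is over the empty set, and its value is `0`. -/
def sphericalNorm {H : Type*} [NormedAddCommGroup H] [InnerProductSpace ℂ H]
    {d : ℕ} (T : Fin d → H →L[ℂ] H) : ℝ :=
  sSup ((fun x : H => Real.sqrt (∑ k, ‖T k x‖ ^ 2)) '' Metric.sphere (0 : H) 1)

variable {H : Type*} [NormedAddCommGroup H] [InnerProductSpace ℂ H] {d : ℕ}

/-- The supremum defining the spherical norm is over a bounded set. -/
theorem bddAbove_sphericalNorm (T : Fin d → H →L[ℂ] H) :
    BddAbove ((fun x : H => Real.sqrt (∑ k, ‖T k x‖ ^ 2)) '' Metric.sphere (0 : H) 1) := by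
  refine ⟨Real.sqrt (∑ k, ‖T k‖ ^ 2), ?_⟩
  rintro _ ⟨x, hx, rfl⟩
  have hx1 : ‖x‖ = 1 := by simpa using hx
  refine Real.sqrt_le_sqrt (Finset.sum_le_sum fun k _ => ?_)
  have := (T k).le_opNorm x
  rw [hx1, mul_one] at this
  gcongr

/-- The joint null space `N(T) = N(T₁) ∩ ⋯ ∩ N(T_d)`. -/
def jointKer (T : Fin d → H →L[ℂ] H) : Submodule ℂ H :=
  ⨅ i, LinearMap.ker (T i : H →ₗ[ℂ] H)

theorem mem_jointKer_iff (T : Fin d → H →L[ℂ] H) (x : H) :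
    x ∈ jointKer T ↔ ∀ i, T i x = 0 := by
  simp [jointKer, Submodule.mem_iInf]

variable [CompleteSpace H]

/-- The positive factor `P = (T₁* T₁ + ⋯ + T_d* T_d)^(1/2)`. -/
def modulus (T : Fin d → H →L[ℂ] H) : H →L[ℂ] H :=
  CFC.sqrt (∑ i, ContinuousLinearMap.adjoint (T i) * T i)

/-- `T = V P` is the canonical spherical polar decomposition of `T`: each `T i` equals `V i * P`,
and `∑ V i* V i` is the orthogonal projection onto `N(T)ᗮ`, that is, the column `V` is a partial
isometry with initial space `N(T)ᗮ`. -/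
structure IsSphericalPolar (T V : Fin d → H →L[ℂ] H) : Prop where
  eq_mul : ∀ i, T i = V i * modulus T
  sum_eq : ∑ i, ContinuousLinearMap.adjoint (V i) * V i = (jointKer T)ᗮ.starProjection

theorem modulus_nonneg (T : Fin d → H →L[ℂ] H) : 0 ≤ modulus T := CFC.sqrt_nonneg _

theorem inner_sum_adjoint_mul (T : Fin d → H →L[ℂ] H) (x y : H) :
    ⟪x, (∑ i, ContinuousLinearMap.adjoint (T i) * T i) y⟫_ℂ = ∑ i, ⟪T i x, T i y⟫_ℂ := by
  simp [ContinuousLinearMap.adjoint_inner_right]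

theorem modulus_mul_self (T : Fin d → H →L[ℂ] H) :
    modulus T * modulus T = ∑ i, ContinuousLinearMap.adjoint (T i) * T i := by
  apply CFC.sqrt_mul_sqrt_self
  exact Finset.sum_nonneg fun i _ => star_mul_self_nonneg (T i)

theorem norm_modulus_apply_sq (T : Fin d → H →L[ℂ] H) (x : H) :
    ‖modulus T x‖ ^ 2 = ∑ i, ‖T i x‖ ^ 2 := by
  have hsa : ContinuousLinearMap.adjoint (modulus T) = modulus T :=
    (IsSelfAdjoint.of_nonneg (modulus_nonneg T)).star_eq
  have h := inner_sum_adjoint_mul T x x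
  rw [← modulus_mul_self, mul_apply_eq_comp,
    ← ContinuousLinearMap.adjoint_inner_left, hsa] at h
  simp only [inner_self_eq_norm_sq_to_K] at h
  exact_mod_cast h

theorem ker_modulus (T : Fin d → H →L[ℂ] H) :
    LinearMap.ker (modulus T : H →ₗ[ℂ] H) = jointKer T := by
  ext x
  rw [mem_jointKer_iff, LinearMap.mem_ker, ContinuousLinearMap.coe_coe]
  have h := norm_modulus_apply_sq T x
  constructor
  · intro hx i
    rw [hx, norm_zero, zero_pow two_ne_zero, eq_comm,
      Finset.sum_eq_zero_iff_of_nonneg fun _ _ => sq_nonneg _] at h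
    simpa using h i (Finset.mem_univ i)
  · intro hx
    simpa [hx] using h

theorem jointKer_orthogonal (T : Fin d → H →L[ℂ] H) :
    (jointKer T)ᗮ = (LinearMap.range (modulus T : H →ₗ[ℂ] H)).topologicalClosure := by
  have hsa : ContinuousLinearMap.adjoint (modulus T) = modulus T :=
    (IsSelfAdjoint.of_nonneg (modulus_nonneg T)).star_eq
  rw [← ker_modulus]
  have := ContinuousLinearMap.orthogonal_ker (modulus T)
  rwa [hsa] at this

/-- The canonical spherical polar decomposition exists and is unique. -/
theorem existsUnique_isSphericalPolar (T : Fin d → H →L[ℂ] H) :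
    ∃! V : Fin d → H →L[ℂ] H, IsSphericalPolar T V := by
  have hP : ∀ x, modulus T x ∈ (jointKer T)ᗮ := fun x => by
    rw [jointKer_orthogonal]
    exact Submodule.le_topologicalClosure _ ⟨x, rfl⟩
  refine existsUnique_of_exists_of_unique ?_ ?_
  · let e : H →ₗ[ℂ] ((jointKer T)ᗮ : Submodule ℂ H) :=
      LinearMap.codRestrict _ (modulus T : H →ₗ[ℂ] H) hP
    have he : ∀ x, ((e x : (jointKer T)ᗮ) : H) = modulus T x := fun x => rfl
    have hd : DenseRange e := by
      rw [DenseRange, Subtype.dense_iff, ← Set.range_comp]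
      intro x hx
      rw [jointKer_orthogonal] at hx
      exact hx
    have hn : ∀ i, ∃ C : ℝ, ∀ x, ‖(T i : H →ₗ[ℂ] H) x‖ ≤ C * ‖e x‖ := by
      refine fun i => ⟨1, fun x => ?_⟩
      rw [one_mul]
      refine (sq_le_sq₀ (norm_nonneg _) (norm_nonneg _)).1 ?_
      have h := norm_modulus_apply_sq T x
      rw [← he, ← Submodule.coe_norm] at h
      rw [h]
      exact Finset.single_le_sum (f := fun i => ‖T i x‖ ^ 2)
        (fun _ _ => sq_nonneg _) (Finset.mem_univ i)
    let W : Fin d → ((jointKer T)ᗮ : Submodule ℂ H) →L[ℂ] H :=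
      fun i => (T i : H →ₗ[ℂ] H).extendOfNorm e
    have hW : ∀ i x, W i (e x) = T i x := fun i x => LinearMap.extendOfNorm_eq hd (hn i) x
    have hiso : ∀ z, ∑ i, ‖W i z‖ ^ 2 = ‖z‖ ^ 2 := by
      intro z
      refine hd.induction_on z (isClosed_eq (by fun_prop) (by fun_prop)) fun x => ?_
      simp only [hW]
      rw [← norm_modulus_apply_sq, ← he, ← Submodule.coe_norm]
    refine ⟨fun i => W i ∘L (jointKer T)ᗮ.orthogonalProjectionOnto, fun i => ?_, ?_⟩
    · ext x
      have : (jointKer T)ᗮ.orthogonalProjectionOnto (modulus T x) = e x :=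
        Submodule.orthogonalProjectionOnto_mem_subspace_eq_self (e x)
      simp [this, hW]
    · refine ContinuousLinearMap.coe_inj.1 ((ext_inner_map _ _).1 fun x => ?_)
      rw [← inner_conj_symm]
      nth_rw 2 [← inner_conj_symm]
      congr 1
      simp only [ContinuousLinearMap.coe_coe]
      rw [inner_sum_adjoint_mul]
      simp only [ContinuousLinearMap.comp_apply, inner_self_eq_norm_sq_to_K]
      have h1 := hiso ((jointKer T)ᗮ.orthogonalProjectionOnto x)
      have h2 : ⟪x, (jointKer T)ᗮ.starProjection x⟫_ℂ
          = ((‖(jointKer T)ᗮ.orthogonalProjectionOnto x‖ ^ 2 : ℝ) : ℂ) := by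
        have hid := DFunLike.congr_fun
          (Submodule.isIdempotentElem_starProjection (jointKer T)ᗮ).eq x
        rw [← hid, mul_apply_eq_comp, ← Submodule.inner_starProjection_left_eq_right,
          inner_self_eq_norm_sq_to_K, Submodule.starProjection_apply, ← Submodule.coe_norm]
        push_cast
        rfl
      rw [h2, ← h1]
      push_cast
      rfl
  · intro V V' hV hV'
    have key : ∀ U : Fin d → H →L[ℂ] H, IsSphericalPolar T U → ∀ i,
        ∀ n ∈ jointKer T, U i n = 0 := by
      intro U hU i n hn
      have h := inner_sum_adjoint_mul U n n
      have h0 : (jointKer T)ᗮ.starProjection n = 0 := by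
        rw [Submodule.starProjection_apply_eq_zero_iff]
        exact Submodule.le_orthogonal_orthogonal _ hn
      rw [hU.sum_eq, h0, inner_zero_right] at h
      simp only [inner_self_eq_norm_sq_to_K] at h
      have h' : ∑ i, ‖U i n‖ ^ 2 = 0 := by
        apply Complex.ofReal_injective
        push_cast
        exact h.symm
      rw [Finset.sum_eq_zero_iff_of_nonneg fun _ _ => sq_nonneg _] at h'
      simpa using h' i (Finset.mem_univ i)
    funext i
    ext x
    have hcl : ∀ z ∈ (jointKer T)ᗮ, V i z = V' i z := by
      intro z hz
      rw [jointKer_orthogonal] at hz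
      refine closure_minimal (t := {z | V i z = V' i z}) ?_
        (isClosed_eq (by fun_prop) (by fun_prop)) hz
      rintro _ ⟨y, rfl⟩
      have h := (hV.eq_mul i).symm.trans (hV'.eq_mul i)
      exact DFunLike.congr_fun h y
    have hx := Submodule.sub_starProjection_mem_orthogonal (K := (jointKer T)ᗮ) x
    have hclosed : IsClosed (jointKer T : Set H) := by
      have : (jointKer T : Set H) = ⋂ i, {x | T i x = 0} := by
        ext y
        simp [mem_jointKer_iff]
      rw [this]
      exact isClosed_iInter fun i => isClosed_eq (by fun_prop) (by fun_prop)
    rw [Submodule.orthogonal_orthogonal_eq_closure,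
      hclosed.submodule_topologicalClosure_eq] at hx
    have h1 := hcl _ (Submodule.starProjection_apply_mem _ x)
    have h2 := key V hV i _ hx
    have h3 := key V' hV' i _ hx
    rw [map_sub, sub_eq_zero] at h2 h3
    rw [h2, h3, h1]

/-- The column `V` of the canonical spherical polar decomposition `T = V P`. -/
def polarPart (T : Fin d → H →L[ℂ] H) : Fin d → H →L[ℂ] H :=
  (existsUnique_isSphericalPolar T).choose

theorem isSphericalPolar_polarPart (T : Fin d → H →L[ℂ] H) :
    IsSphericalPolar T (polarPart T) :=
  (existsUnique_isSphericalPolar T).choose_spec.1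

/-- The spherical Aluthge transform, with entries `P^(1/2) V_i P^(1/2)`. -/
def aluthge (T : Fin d → H →L[ℂ] H) : Fin d → H →L[ℂ] H :=
  fun i => modulus T ^ (1 / 2 : ℝ) * polarPart T i * modulus T ^ (1 / 2 : ℝ)

/-- The spherical Duggal transform, with entries `P V_i`. -/
def duggal (T : Fin d → H →L[ℂ] H) : Fin d → H →L[ℂ] H :=
  fun i => modulus T * polarPart T i

/-- The generalized spherical Aluthge transform, with entries `P^t V_i P^(1-t)`. Real powers are
those of the continuous functional calculus; in particular `P^0` is the identity. -/
def genAluthge (T : Fin d → H →L[ℂ] H) (t : ℝ) : Fin d → H →L[ℂ] H :=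
  fun i => modulus T ^ t * polarPart T i * modulus T ^ (1 - t)

/-- The spherical Heinz transform, with entries `(P^t V_i P^(1-t) + P^(1-t) V_i P^t) / 2`. -/
def heinz (T : Fin d → H →L[ℂ] H) (t : ℝ) : Fin d → H →L[ℂ] H :=
  (1 / 2 : ℂ) • (genAluthge T t + genAluthge T (1 - t))

end

end SphericalTransforms

/-! A tuple is encoded as its column operator from `H` to the direct sum of `d` copies of `H`, whose
operator norm is the spherical norm. Multiplying every entry on the left by `S` becomes composition
with `diagonal d S`, so everything reduces to norms of `a t ∘L X ∘L b (1 - t)`, where `a t` is the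
diagonal of `P ^ t`, `b t = P ^ t`, and `X` is the column of `V`.

The lower bound is the Heinz mean inequality, which follows from the operator arithmetic-geometric
mean inequality `two_mul_norm_comp_le`. The middle bound is the triangle inequality together with
Heinz interpolation (`norm_comp_le_rpow_mul_rpow`), whose end values are the norms of the Duggal
transform and of `T`. The remaining bounds are scalar weighted AM-GM and `‖T^D‖ ≤ ‖T‖`, the latter
because the column of `V` is a contraction and `‖P‖ = ‖T‖`. -/

namespace SphericalTransforms

open ContinuousLinearMap Set Filter Topology

open scoped InnerProductSpace

/-! ### The operator arithmetic-geometric mean inequality. -/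

section OperatorInequalities

variable {E F : Type*} [NormedAddCommGroup E] [InnerProductSpace ℂ E] [CompleteSpace E]
  [NormedAddCommGroup F] [InnerProductSpace ℂ F] [CompleteSpace F]

/-- Expand the square and use `‖C* C x‖ ≤ ‖C‖ ‖C x‖`. Consequently unit vectors nearly attaining
`‖C‖` are approximate eigenvectors of `C* C` for `‖C‖ ^ 2`. -/
theorem norm_sq_smul_sub_adjoint_apply_le (C : E →L[ℂ] F) (x : E) :
    ‖((‖C‖ ^ 2 : ℝ) : ℂ) • x - adjoint C (C x)‖ ^ 2
      ≤ ‖C‖ ^ 2 * (‖C‖ ^ 2 * ‖x‖ ^ 2 - ‖C x‖ ^ 2) := by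
  have h1 : ‖adjoint C (C x)‖ ≤ ‖C‖ * ‖C x‖ := by
    simpa using (adjoint C).le_opNorm (C x)
  have h2 : ‖adjoint C (C x)‖ ^ 2 ≤ (‖C‖ * ‖C x‖) ^ 2 := by gcongr
  rw [@norm_sub_sq ℂ, inner_smul_left, adjoint_inner_right, inner_self_eq_norm_sq_to_K, norm_smul,
    Complex.conj_ofReal, Complex.norm_real, Real.norm_of_nonneg (sq_nonneg _)]
  have h3 : RCLike.re (((‖C‖ ^ 2 : ℝ) : ℂ) * ((‖C x‖ : ℂ)) ^ 2) = ‖C‖ ^ 2 * ‖C x‖ ^ 2 := by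
    rw [← Complex.ofReal_pow, ← Complex.ofReal_mul]
    exact Complex.ofReal_re _
  erw [h3]
  nlinarith

/-- The quantitative form, at a single vector, of the arithmetic-geometric mean inequality. -/
theorem two_mul_norm_sub_mul_norm_sq_le (a : F →L[ℂ] F) (b : E →L[ℂ] E) (ha : IsSelfAdjoint a)
    (hb : IsSelfAdjoint b) (Y : E →L[ℂ] F) (x : E)
    (hN : ‖a ∘L a ∘L Y + Y ∘L b ∘L b‖ ≤ 2 * ‖a ∘L Y ∘L b‖) :
    (2 * ‖a ∘L Y ∘L b‖ - ‖a ∘L a ∘L Y + Y ∘L b ∘L b‖) * ‖(a ∘L Y ∘L b) x‖ ^ 2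
      ≤ ‖b ∘L adjoint Y‖ * ‖b‖ * ‖x‖ *
        ‖((‖a ∘L Y ∘L b‖ ^ 2 : ℝ) : ℂ) • x - adjoint (a ∘L Y ∘L b) ((a ∘L Y ∘L b) x)‖ := by
  have ha' := ha.adjoint_eq
  have hb' := hb.adjoint_eq
  set C := a ∘L Y ∘L b with hC
  set W := a ∘L a ∘L Y + Y ∘L b ∘L b with hW
  set e := ((‖C‖ ^ 2 : ℝ) : ℂ) • x - adjoint C (C x) with he
  set y := b x with hy
  set v := a (C x) with hv
  have hCadj : ∀ z, adjoint C z = b (adjoint Y (a z)) := by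
    intro z
    simp [hC, adjoint_comp, ha', hb']
  -- If `x` were an exact eigenvector, then `e = 0` and this pairing would be at least `2 * ‖C‖ *
  -- ‖v‖ * ‖y‖`; the term in `b e` is the error.
  have h1 : ⟪v, W y⟫_ℂ = (‖v‖ ^ 2 + ‖C‖ ^ 2 * ‖y‖ ^ 2 : ℝ) - ⟪b e, y⟫_ℂ := by
    have e1 : W y = v + Y (b (b y)) := by simp [hW, hv, hC, hy]
    have e2 : ⟪v, Y (b (b y))⟫_ℂ = ⟪b (adjoint C (C x)), y⟫_ℂ := by
      rw [← adjoint_inner_left, hCadj, ← adjoint_inner_left b, hb', ← adjoint_inner_left b, hb']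
    have e3 : adjoint C (C x) = ((‖C‖ ^ 2 : ℝ) : ℂ) • x - e := by simp [he]
    have e4 : ⟪v, v⟫_ℂ = (‖v‖ : ℂ) ^ 2 := inner_self_eq_norm_sq_to_K v
    have e5 : ⟪y, y⟫_ℂ = (‖y‖ : ℂ) ^ 2 := inner_self_eq_norm_sq_to_K y
    rw [e1, inner_add_right, e2, e3, map_sub, map_smul, inner_sub_left, inner_smul_left,
      Complex.conj_ofReal, ← hy, e4, e5]
    push_cast
    ring
  have h2 : ‖⟪v, W y⟫_ℂ‖ ≤ ‖W‖ * ‖v‖ * ‖y‖ := by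
    refine (norm_inner_le_norm _ _).trans ?_
    have := W.le_opNorm y
    nlinarith [norm_nonneg v]
  have h3 : ‖⟪b e, y⟫_ℂ‖ ≤ ‖b‖ * ‖e‖ * ‖y‖ := by
    refine (norm_inner_le_norm _ _).trans ?_
    gcongr
    exact b.le_opNorm e
  have h4 : ‖v‖ ^ 2 + ‖C‖ ^ 2 * ‖y‖ ^ 2 ≤ ‖W‖ * ‖v‖ * ‖y‖ + ‖b‖ * ‖e‖ * ‖y‖ := by
    have := congrArg Complex.re h1
    rw [Complex.sub_re, Complex.ofReal_re] at this
    have r1 := (Complex.re_le_norm ⟪v, W y⟫_ℂ).trans h2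
    have r2 := (Complex.re_le_norm ⟪b e, y⟫_ℂ).trans h3
    linarith
  have h5 : (2 * ‖C‖ - ‖W‖) * ‖v‖ ≤ ‖b‖ * ‖e‖ := by
    rcases (norm_nonneg y).eq_or_lt with h0 | h0
    · have hy0 : b x = 0 := norm_eq_zero.1 h0.symm
      have : v = 0 := by simp [hv, hC, hy0]
      rw [this, norm_zero, mul_zero]
      positivity
    · refine le_of_mul_le_mul_right ?_ h0
      nlinarith [sq_nonneg (‖v‖ - ‖C‖ * ‖y‖)]
  -- A lower bound for `‖v‖`, from `‖C x‖ ^ 2 = ⟪C* C x, x⟫` and `C* C x = b Y* v`.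
  have h6 : ‖C x‖ ^ 2 ≤ ‖b ∘L adjoint Y‖ * ‖v‖ * ‖x‖ := by
    have h := apply_norm_sq_eq_inner_adjoint_left C x
    rw [h]
    refine (Complex.re_le_norm _).trans ((norm_inner_le_norm _ _).trans ?_)
    gcongr
    change ‖adjoint C (C x)‖ ≤ _
    rw [hCadj]
    exact (b ∘L adjoint Y).le_opNorm v
  calc (2 * ‖C‖ - ‖W‖) * ‖C x‖ ^ 2
      ≤ (2 * ‖C‖ - ‖W‖) * (‖b ∘L adjoint Y‖ * ‖v‖ * ‖x‖) :=
        mul_le_mul_of_nonneg_left h6 (sub_nonneg.2 hN)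
    _ = ‖b ∘L adjoint Y‖ * ‖x‖ * ((2 * ‖C‖ - ‖W‖) * ‖v‖) := by ring
    _ ≤ ‖b ∘L adjoint Y‖ * ‖x‖ * (‖b‖ * ‖e‖) := by gcongr
    _ = _ := by ring

/-- The operator arithmetic-geometric mean inequality `2 ‖a Y b‖ ≤ ‖a² Y + Y b²‖`. -/
theorem two_mul_norm_comp_le (a : F →L[ℂ] F) (b : E →L[ℂ] E) (ha : IsSelfAdjoint a)
    (hb : IsSelfAdjoint b) (Y : E →L[ℂ] F) :
    2 * ‖a ∘L Y ∘L b‖ ≤ ‖a ∘L a ∘L Y + Y ∘L b ∘L b‖ := by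
  by_contra! hlt
  have key := fun x => two_mul_norm_sub_mul_norm_sq_le a b ha hb Y x hlt.le
  have hE := fun x => norm_sq_smul_sub_adjoint_apply_le (a ∘L Y ∘L b) x
  have hsup := (a ∘L Y ∘L b).sSup_unitClosedBall_eq_norm
  generalize a ∘L Y ∘L b = C at *
  have hN0 := norm_nonneg (a ∘L a ∘L Y + Y ∘L b ∘L b)
  generalize ‖a ∘L a ∘L Y + Y ∘L b ∘L b‖ = N at *
  generalize hK : ‖b ∘L adjoint Y‖ * ‖b‖ = K at *
  have hK0 : 0 ≤ K := hK ▸ by positivity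
  have hbd : ∀ x : E, ‖x‖ ≤ 1 → ‖C x‖ ≤ ‖C‖ := fun x hx =>
    (C.le_opNorm x).trans (mul_le_of_le_one_right (norm_nonneg _) hx)
  -- The norm need not be attained. Instead, an inequality closed in `r` is shown for `r = ‖C x‖`
  -- and passed to `r = ‖C‖`, where its right side vanishes.
  have hmem : ‖C‖ ∈ closure ((fun x => ‖C x‖) '' Metric.closedBall (0 : E) 1) := by
    have h := csSup_mem_closure (s := (fun x => ‖C x‖) '' Metric.closedBall (0 : E) 1)
      ⟨_, 0, by simp, rfl⟩ ⟨‖C‖, by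
        rintro _ ⟨x, hx, rfl⟩
        exact hbd x (by simpa using hx)⟩
    rwa [hsup] at h
  have hcl : IsClosed {r : ℝ | ((2 * ‖C‖ - N) * r ^ 2) ^ 2
      ≤ K ^ 2 * (‖C‖ ^ 2 * (‖C‖ ^ 2 - r ^ 2))} :=
    isClosed_le (by fun_prop) (by fun_prop)
  have h := closure_minimal (t := {r : ℝ | ((2 * ‖C‖ - N) * r ^ 2) ^ 2
      ≤ K ^ 2 * (‖C‖ ^ 2 * (‖C‖ ^ 2 - r ^ 2))}) ?_ hcl hmem
  · simp only [mem_ofPred_eq, sub_self, mul_zero] at h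
    have h0 : (2 * ‖C‖ - N) * ‖C‖ ^ 2 = 0 := pow_eq_zero_iff two_ne_zero |>.1
      (le_antisymm h (sq_nonneg _))
    rcases mul_eq_zero.1 h0 with h1 | h1
    · linarith
    · have hC0 : C = 0 := by simpa using h1
      rw [hC0, norm_zero, mul_zero] at hlt
      linarith
  · rintro _ ⟨x, hx, rfl⟩
    have hx1 : ‖x‖ ≤ 1 := by simpa using hx
    have k1 := key x
    have k2 := hE x
    have k3 : K * ‖x‖ * ‖((‖C‖ ^ 2 : ℝ) : ℂ) • x - adjoint C (C x)‖
        ≤ K * ‖((‖C‖ ^ 2 : ℝ) : ℂ) • x - adjoint C (C x)‖ := by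
      gcongr
      exact mul_le_of_le_one_right hK0 hx1
    calc ((2 * ‖C‖ - N) * ‖C x‖ ^ 2) ^ 2
        ≤ (K * ‖((‖C‖ ^ 2 : ℝ) : ℂ) • x - adjoint C (C x)‖) ^ 2 :=
          pow_le_pow_left₀ (mul_nonneg (by linarith) (sq_nonneg _)) (k1.trans k3) 2
      _ ≤ K ^ 2 * (‖C‖ ^ 2 * (‖C‖ ^ 2 * ‖x‖ ^ 2 - ‖C x‖ ^ 2)) := by
          rw [mul_pow]; gcongr
      _ ≤ _ := by
          have : ‖x‖ ^ 2 ≤ 1 := pow_le_one₀ (norm_nonneg _) hx1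
          gcongr
          exact mul_le_of_le_one_right (sq_nonneg _) this

/-! ### Log-convexity in `t` and Heinz interpolation. -/

/-- If a product of two operators is self-adjoint, its norm is at most that of the reversed
product. -/
theorem norm_mul_le_norm_mul_swap {A : Type*} [CStarAlgebra A] {c d : A}
    (h : IsSelfAdjoint (c * d)) : ‖c * d‖ ≤ ‖d * c‖ := by
  nontriviality A
  -- `c * d` and `d * c` have the same nonzero spectrum, and the norm of a self-adjoint element is
  -- its spectral radius.
  have h1 : spectralRadius ℂ (c * d) ≤ (‖d * c‖₊ : ENNReal) := by
    refine iSup₂_le fun k hk => ?_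
    by_cases hk0 : k = 0
    · simp [hk0]
    · have : k ∈ spectrum ℂ (d * c) \ {0} := by
        rw [← spectrum.nonzero_mul_comm]
        exact ⟨hk, hk0⟩
      exact mod_cast spectrum.norm_le_norm_of_mem this.1
  rw [h.spectralRadius_eq_nnnorm] at h1
  exact mod_cast h1

/-- By the C*-identity the left side is the norm of a self-adjoint product with leftmost factor `c`.
Moving `c` to the right end does not decrease the norm, and the result splits between `a₁` and `a₂`.
-/
theorem norm_comp_sq_le {a a₁ a₂ : F →L[ℂ] F} {b c : E →L[ℂ] E} (ha : IsSelfAdjoint a)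
    (ha₁ : IsSelfAdjoint a₁) (haa : a * a = a₁ * a₂)
    (hb : IsSelfAdjoint b) (hc : IsSelfAdjoint c) (hbc : Commute c b) (X : E →L[ℂ] F) :
    ‖a ∘L X ∘L (c * b)‖ ^ 2 ≤ ‖a₁ ∘L X ∘L b‖ * ‖a₂ ∘L X ∘L (c * b * c)‖ := by
  have hcb : adjoint (c * b) = c * b := by
    change star (c * b) = c * b
    rw [star_mul, hb.star_eq, hc.star_eq, hbc.eq]
  have e : adjoint (a ∘L X ∘L (c * b)) ∘L (a ∘L X ∘L (c * b))
      = c * (b ∘L adjoint X ∘L a₁ ∘L a₂ ∘L X ∘L (c * b)) := by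
    ext x
    have h1 : ∀ z, a (a z) = a₁ (a₂ z) := fun z => DFunLike.congr_fun haa z
    simp [adjoint_comp, hcb, ha.adjoint_eq, h1]
  have e2 : (b ∘L adjoint X ∘L a₁ ∘L a₂ ∘L X ∘L (c * b)) * c
      = adjoint (a₁ ∘L X ∘L b) ∘L (a₂ ∘L X ∘L (c * b * c)) := by
    ext x
    simp [adjoint_comp, hb.adjoint_eq, ha₁.adjoint_eq]
  rw [sq, ← norm_adjoint_comp_self, e]
  have hsa : IsSelfAdjoint (c * (b ∘L adjoint X ∘L a₁ ∘L a₂ ∘L X ∘L (c * b))) := by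
    rw [← e]
    rw [isSelfAdjoint_iff', adjoint_comp, adjoint_adjoint]
  refine (norm_mul_le_norm_mul_swap hsa).trans ?_
  rw [e2]
  refine (opNorm_comp_le _ _).trans_eq ?_
  rw [LinearIsometryEquiv.norm_map]

/-- A family of self-adjoint operators indexed by the nonnegative reals, multiplicative in the
index and bounded on the unit interval. -/
structure IsSelfAdjointSemigroup (a : ℝ → E →L[ℂ] E) : Prop where
  zero : a 0 = 1
  add : ∀ {s t : ℝ}, 0 ≤ s → 0 ≤ t → a (s + t) = a s * a t
  isSelfAdjoint : ∀ t, IsSelfAdjoint (a t)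
  bounded : ∃ M, ∀ t ∈ Icc (0 : ℝ) 1, ‖a t‖ ≤ M

namespace IsSelfAdjointSemigroup

variable {a : ℝ → F →L[ℂ] F} {b : ℝ → E →L[ℂ] E}

theorem commute (hb : IsSelfAdjointSemigroup b) {s t : ℝ} (hs : 0 ≤ s) (ht : 0 ≤ t) :
    Commute (b s) (b t) := by
  rw [Commute, SemiconjBy, ← hb.add hs ht, ← hb.add ht hs, add_comm]

theorem norm_midpoint_sq_le (ha : IsSelfAdjointSemigroup a) (hb : IsSelfAdjointSemigroup b)
    (X : E →L[ℂ] F) {s t : ℝ} (hs : 0 ≤ s) (hst : s ≤ t) (ht : t ≤ 1) :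
    ‖a ((s + t) / 2) ∘L X ∘L b (1 - (s + t) / 2)‖ ^ 2
      ≤ ‖a t ∘L X ∘L b (1 - t)‖ * ‖a s ∘L X ∘L b (1 - s)‖ := by
  have hd : 0 ≤ (t - s) / 2 := by linarith
  have ht' : 0 ≤ 1 - t := by linarith
  have e1 : b (1 - (s + t) / 2) = b ((t - s) / 2) * b (1 - t) := by
    rw [← hb.add hd ht']; congr 1; ring
  have e2 : b (1 - s) = b ((t - s) / 2) * b (1 - t) * b ((t - s) / 2) := by
    rw [← hb.add hd ht', ← hb.add (by linarith) hd]; congr 1; ring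
  rw [e1, e2]
  refine norm_comp_sq_le (ha.isSelfAdjoint _) (ha.isSelfAdjoint _) ?_ (hb.isSelfAdjoint _)
    (hb.isSelfAdjoint _) (hb.commute hd ht') X
  rw [← ha.add (by linarith) (by linarith), ← ha.add (by linarith) hs]
  congr 1; ring

/-- Boundedness replaces continuity in the interpolation: with `P ^ 0 = 1`, the map `t ↦ P ^ t` can
be norm discontinuous at `0`. -/
theorem exists_norm_comp_le (ha : IsSelfAdjointSemigroup a) (hb : IsSelfAdjointSemigroup b)
    (X : E →L[ℂ] F) : ∃ M, ∀ t ∈ Icc (0 : ℝ) 1, ‖a t ∘L X ∘L b (1 - t)‖ ≤ M := by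
  obtain ⟨A, hA⟩ := ha.bounded
  obtain ⟨B, hB⟩ := hb.bounded
  refine ⟨A * (‖X‖ * B), fun t ht => ?_⟩
  have hA0 : 0 ≤ A := (norm_nonneg _).trans (hA t ht)
  refine (opNorm_comp_le _ _).trans ?_
  gcongr
  · exact hA t ht
  · refine (opNorm_comp_le _ _).trans ?_
    gcongr
    exact hB _ ⟨by linarith [ht.2], by linarith [ht.1]⟩

end IsSelfAdjointSemigroup

/-- A bounded nonnegative function on `[0, 1]` that is logarithmically midpoint convex lies below
the logarithmic interpolation of upper bounds of its end values. -/
theorem le_rpow_mul_rpow_of_midpoint {f : ℝ → ℝ} (hf0 : ∀ t, 0 ≤ f t)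
    (hbdd : ∃ M, ∀ t ∈ Icc (0 : ℝ) 1, f t ≤ M)
    (hmid : ∀ {s t : ℝ}, 0 ≤ s → s ≤ t → t ≤ 1 → f ((s + t) / 2) ^ 2 ≤ f t * f s)
    {α β : ℝ} (hα : 0 < α) (hβ : 0 < β) (h1 : f 1 ≤ α) (h0 : f 0 ≤ β)
    {t : ℝ} (ht : t ∈ Icc (0 : ℝ) 1) : f t ≤ α ^ t * β ^ (1 - t) := by
  have hg : ∀ t : ℝ, 0 < α ^ t * β ^ (1 - t) := fun t => by positivity
  set g : ℝ → ℝ := fun t => α ^ t * β ^ (1 - t) with hgdef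
  have hgc : Continuous g := by
    have c1 : Continuous fun t : ℝ => α ^ t := Real.continuous_const_rpow hα.ne'
    have c2 : Continuous fun t : ℝ => β ^ t := Real.continuous_const_rpow hβ.ne'
    exact c1.mul (c2.comp (continuous_const.sub continuous_id))
  have hbd : BddAbove ((fun t => f t / g t) '' Icc (0 : ℝ) 1) := by
    obtain ⟨M, hM⟩ := hbdd
    obtain ⟨L, hL⟩ := (isCompact_Icc (a := (0 : ℝ)) (b := 1)).bddAbove_image
      ((hgc.inv₀ fun t => (hg t).ne').continuousOn)
    refine ⟨M * L, ?_⟩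
    rintro _ ⟨s, hs, rfl⟩
    have h1 := hM s hs
    have h2 : (g s)⁻¹ ≤ L := hL ⟨s, hs, rfl⟩
    change f s / g s ≤ _
    rw [div_eq_mul_inv]
    exact mul_le_mul h1 h2 (inv_nonneg.2 (hg s).le) ((hf0 s).trans h1)
  set M := sSup ((fun t => f t / g t) '' Icc (0 : ℝ) 1) with hM
  have hle : ∀ s ∈ Icc (0 : ℝ) 1, f s ≤ M * g s := fun s hs =>
    (div_le_iff₀ (hg s)).1 (le_csSup hbd ⟨s, hs, rfl⟩)
  have hM0 : 0 ≤ M := Real.sSup_nonneg (by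
    rintro _ ⟨s, -, rfl⟩
    exact div_nonneg (hf0 s) (hg s).le)
  have hg0 : g 0 = β := by simp [hgdef]
  have hg1 : g 1 = α := by simp [hgdef]
  have hgm : ∀ s t : ℝ, g ((s + t) / 2) ^ 2 = g t * g s := by
    intro s t
    simp only [hgdef]
    rw [mul_pow, ← Real.rpow_mul_natCast hα.le, ← Real.rpow_mul_natCast hβ.le,
      mul_mul_mul_comm, ← Real.rpow_add hα, ← Real.rpow_add hβ]
    congr 2 <;> push_cast <;> ring
  -- Every `s` is the midpoint of `0` and `2 * s` or of `2 * s - 1` and `1`. At the endpoint `f ≤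
  -- g`, so only one factor `M` is lost; hence `M ≤ √M` and `M ≤ 1`.
  have hsq : ∀ s ∈ Icc (0 : ℝ) 1, f s ^ 2 ≤ M * g s ^ 2 := by
    intro s hs
    rcases le_total s (1 / 2) with h | h
    · have e := hmid (s := 0) (t := 2 * s) le_rfl (by linarith [hs.1]) (by linarith)
      have e' := hgm 0 (2 * s)
      rw [show (0 + 2 * s) / 2 = s by ring] at e e'
      rw [e', hg0, ← mul_assoc]
      exact e.trans (mul_le_mul (hle _ ⟨by linarith [hs.1], by linarith⟩) h0 (hf0 _)
        (mul_nonneg hM0 (hg _).le))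
    · have e := hmid (s := 2 * s - 1) (t := 1) (by linarith) (by linarith [hs.2]) le_rfl
      have e' := hgm (2 * s - 1) 1
      rw [show (2 * s - 1 + 1) / 2 = s by ring] at e e'
      rw [e', hg1, mul_left_comm]
      exact e.trans (mul_le_mul h1 (hle _ ⟨by linarith, by linarith [hs.2]⟩) (hf0 _) hα.le)
  have hMs : M ≤ √M := by
    refine csSup_le ⟨_, 0, by simp, rfl⟩ ?_
    rintro _ ⟨s, hs, rfl⟩
    refine Real.le_sqrt_of_sq_le ?_
    change (f s / g s) ^ 2 ≤ M
    rw [div_pow, div_le_iff₀ (pow_pos (hg s) 2)]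
    exact hsq s hs
  have hM1 : M ≤ 1 := by
    by_contra! h
    have h2 := Real.sq_sqrt hM0
    nlinarith
  exact (hle t ht).trans (mul_le_of_le_one_left (hg t).le hM1)

namespace IsSelfAdjointSemigroup

variable {a : ℝ → F →L[ℂ] F} {b : ℝ → E →L[ℂ] E}

/-- Heinz's interpolation inequality. -/
theorem norm_comp_le_rpow_mul_rpow (ha : IsSelfAdjointSemigroup a)
    (hb : IsSelfAdjointSemigroup b) (X : E →L[ℂ] F) {t : ℝ} (ht : t ∈ Icc (0 : ℝ) 1) :
    ‖a t ∘L X ∘L b (1 - t)‖ ≤ ‖a 1 ∘L X‖ ^ t * ‖X ∘L b 1‖ ^ (1 - t) := by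
  rcases ht.1.eq_or_lt with rfl | ht0
  · simp [ha.zero, one_def]
  rcases ht.2.eq_or_lt with rfl | ht1
  · simp [hb.zero, one_def]
  -- The `ε` keeps both end bounds positive when an end norm vanishes.
  have key : ∀ ε > 0, ‖a t ∘L X ∘L b (1 - t)‖
      ≤ (‖a 1 ∘L X‖ + ε) ^ t * (‖X ∘L b 1‖ + ε) ^ (1 - t) := by
    intro ε hε
    refine le_rpow_mul_rpow_of_midpoint (f := fun t => ‖a t ∘L X ∘L b (1 - t)‖)
      (fun _ => norm_nonneg _) (ha.exists_norm_comp_le hb X)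
      (ha.norm_midpoint_sq_le hb X) (by positivity) (by positivity) ?_ ?_ ht
    · simp [hb.zero, one_def, hε.le]
    · simp [ha.zero, one_def, hε.le]
  have hc : Continuous fun ε : ℝ =>
      (‖a 1 ∘L X‖ + ε) ^ t * (‖X ∘L b 1‖ + ε) ^ (1 - t) :=
    ((Real.continuous_rpow_const ht0.le).comp (continuous_const.add continuous_id)).mul
      ((Real.continuous_rpow_const (by linarith)).comp (continuous_const.add continuous_id))
  have hlim := (hc.tendsto 0).mono_left (nhdsWithin_le_nhds (s := Ioi 0))
  simp only [add_zero] at hlim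
  exact ge_of_tendsto hlim (eventually_mem_nhdsWithin.mono fun ε hε => key ε hε)

theorem two_mul_norm_comp_half_le_of_le_half (ha : IsSelfAdjointSemigroup a)
    (hb : IsSelfAdjointSemigroup b) (X : E →L[ℂ] F) {t : ℝ} (ht0 : 0 ≤ t) (ht : t ≤ 1 / 2) :
    2 * ‖a (1 / 2) ∘L X ∘L b (1 / 2)‖
      ≤ ‖a t ∘L X ∘L b (1 - t) + a (1 - t) ∘L X ∘L b t‖ := by
  have hr : 0 ≤ 1 / 2 - t := by linarith
  -- With `r = 1 / 2 - t`, the exponents add up as `r + t = 1 / 2` and `2 * r + t = 1 - t`.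
  have h := two_mul_norm_comp_le (a (1 / 2 - t)) (b (1 / 2 - t)) (ha.isSelfAdjoint _)
    (hb.isSelfAdjoint _) (a t ∘L X ∘L b t)
  have ea : a (1 / 2) = a (1 / 2 - t) * a t := by rw [← ha.add hr ht0]; congr 1; ring
  have eb : b (1 / 2) = b t * b (1 / 2 - t) := by rw [← hb.add ht0 hr]; congr 1; ring
  have ea' : a (1 - t) = a (1 / 2 - t) * a (1 / 2 - t) * a t := by
    rw [← ha.add hr hr, ← ha.add (by linarith) ht0]; congr 1; ring
  have eb' : b (1 - t) = b t * (b (1 / 2 - t) * b (1 / 2 - t)) := by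
    rw [← hb.add hr hr, ← hb.add ht0 (by linarith)]; congr 1; ring
  rw [ea, eb, ea', eb', add_comm]
  exact h

/-- The Heinz mean inequality. -/
theorem two_mul_norm_comp_half_le (ha : IsSelfAdjointSemigroup a)
    (hb : IsSelfAdjointSemigroup b) (X : E →L[ℂ] F) {t : ℝ} (ht : t ∈ Icc (0 : ℝ) 1) :
    2 * ‖a (1 / 2) ∘L X ∘L b (1 / 2)‖
      ≤ ‖a t ∘L X ∘L b (1 - t) + a (1 - t) ∘L X ∘L b t‖ := by
  rcases le_total t (1 / 2) with h | h
  · exact ha.two_mul_norm_comp_half_le_of_le_half hb X ht.1 h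
  · have := ha.two_mul_norm_comp_half_le_of_le_half hb X (t := 1 - t) (by linarith [ht.2])
      (by linarith)
    rwa [sub_sub_cancel, add_comm] at this

end IsSelfAdjointSemigroup

end OperatorInequalities

/-! ### Tuples as column operators on a direct sum. -/

noncomputable section

variable {H : Type*} [NormedAddCommGroup H] [InnerProductSpace ℂ H] {d : ℕ}

/-- The Hilbert space direct sum of `d` copies of `H`. -/
def HilbertPower (d : ℕ) (H : Type*) := PiLp 2 fun _ : Fin d => H

namespace HilbertPower

instance : NormedAddCommGroup (HilbertPower d H) :=
  inferInstanceAs (NormedAddCommGroup (PiLp 2 fun _ : Fin d => H))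

instance : InnerProductSpace ℂ (HilbertPower d H) :=
  inferInstanceAs (InnerProductSpace ℂ (PiLp 2 fun _ : Fin d => H))

instance [CompleteSpace H] : CompleteSpace (HilbertPower d H) :=
  inferInstanceAs (CompleteSpace (PiLp 2 fun _ : Fin d => H))

/-- The coordinate projections. -/
def proj (i : Fin d) : HilbertPower d H →L[ℂ] H := PiLp.proj 2 (fun _ : Fin d => H) i

/-- The operator with prescribed coordinates. -/
def lift {E : Type*} [NormedAddCommGroup E] [NormedSpace ℂ E] (T : Fin d → E →L[ℂ] H) :
    E →L[ℂ] HilbertPower d H :=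
  (PiLp.continuousLinearEquiv 2 ℂ fun _ : Fin d => H).symm.toContinuousLinearMap ∘L
    ContinuousLinearMap.pi T

@[ext]
theorem ext {x y : HilbertPower d H} (h : ∀ i, proj i x = proj i y) : x = y :=
  PiLp.ext h

theorem norm_sq_eq (x : HilbertPower d H) : ‖x‖ ^ 2 = ∑ i, ‖proj i x‖ ^ 2 :=
  PiLp.norm_sq_eq_of_L2 (fun _ : Fin d => H) x

theorem inner_eq (x y : HilbertPower d H) : ⟪x, y⟫_ℂ = ∑ i, ⟪proj i x, proj i y⟫_ℂ :=
  PiLp.inner_apply (𝕜 := ℂ) (f := fun _ : Fin d => H) x y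

end HilbertPower

open HilbertPower

/-- The column operator `x ↦ (T₁ x, …, T_d x)` of a tuple. -/
def column (T : Fin d → H →L[ℂ] H) : H →L[ℂ] HilbertPower d H := lift T

@[simp]
theorem proj_column (T : Fin d → H →L[ℂ] H) (x : H) (i : Fin d) :
    proj i (column T x) = T i x := rfl

theorem column_add (T S : Fin d → H →L[ℂ] H) : column (T + S) = column T + column S := by
  ext; simp

theorem column_smul (c : ℂ) (T : Fin d → H →L[ℂ] H) : column (c • T) = c • column T := by
  ext; simp

/-- The operator acting on each coordinate of the direct sum of `d` copies of `H` as `S`. -/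
def diagonal (d : ℕ) (S : H →L[ℂ] H) : HilbertPower d H →L[ℂ] HilbertPower d H :=
  lift fun i => S ∘L proj i

@[simp]
theorem proj_diagonal (S : H →L[ℂ] H) (x : HilbertPower d H) (i : Fin d) :
    proj i (diagonal d S x) = S (proj i x) := rfl

theorem diagonal_one : diagonal d (1 : H →L[ℂ] H) = 1 := by
  ext; simp

theorem diagonal_mul (S R : H →L[ℂ] H) : diagonal d (S * R) = diagonal d S * diagonal d R := by
  ext; simp

theorem norm_diagonal_le (S : H →L[ℂ] H) : ‖diagonal d S‖ ≤ ‖S‖ := by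
  refine opNorm_le_bound _ (norm_nonneg _) fun x => ?_
  refine (sq_le_sq₀ (norm_nonneg _) (by positivity)).1 ?_
  rw [mul_pow, norm_sq_eq, norm_sq_eq, Finset.mul_sum]
  refine Finset.sum_le_sum fun i _ => ?_
  rw [← mul_pow]
  exact pow_le_pow_left₀ (norm_nonneg _) (S.le_opNorm _) 2

theorem column_mul_mul (S R : H →L[ℂ] H) (V : Fin d → H →L[ℂ] H) :
    column (fun i => S * V i * R) = diagonal d S ∘L column V ∘L R := by
  ext; simp

theorem norm_column (T : Fin d → H →L[ℂ] H) : ‖column T‖ = sphericalNorm T := by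
  have h : (fun x : H => √(∑ k, ‖T k x‖ ^ 2)) = fun x => ‖column T x‖ := by
    ext x
    rw [← Real.sqrt_sq (norm_nonneg (column T x)), norm_sq_eq]
    rfl
  -- In the zero space the sphere is empty, and `sSup ∅ = 0` agrees with the operator norm.
  rw [sphericalNorm, h, sSup_sphere_eq_norm]

theorem sphericalNorm_nonneg (T : Fin d → H →L[ℂ] H) : 0 ≤ sphericalNorm T :=
  norm_column T ▸ norm_nonneg _

variable [CompleteSpace H]

theorem isSelfAdjoint_diagonal {S : H →L[ℂ] H} (hS : IsSelfAdjoint S) :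
    IsSelfAdjoint (diagonal d S) := by
  rw [isSelfAdjoint_iff_isSymmetric] at hS ⊢
  intro x y
  simp only [coe_coe, inner_eq]
  exact Finset.sum_congr rfl fun i _ => hS (proj i x) (proj i y)

theorem isSelfAdjointSemigroup_rpow {P : H →L[ℂ] H} (hP : 0 ≤ P) :
    IsSelfAdjointSemigroup fun t : ℝ => P ^ t where
  zero := CFC.rpow_zero P
  add {s t} hs ht := by
    simp only [CFC.rpow_def]
    rw [← cfc_mul _ _ P (by fun_prop) (by fun_prop)]
    -- Nonnegative exponents make the power law valid at `x = 0`, so `P` need not be invertible.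
    exact cfc_congr fun x _ => NNReal.rpow_add_of_nonneg x hs ht
  isSelfAdjoint t := IsSelfAdjoint.of_nonneg CFC.rpow_nonneg
  bounded := by
    refine ⟨max 1 ‖P‖, fun t ht => ?_⟩
    rcases ht.1.eq_or_lt with rfl | h0
    · rw [CFC.rpow_zero P]
      exact norm_id_le.trans (le_max_left _ _)
    · rw [CFC.norm_rpow P h0]
      calc ‖P‖ ^ t ≤ max 1 ‖P‖ ^ t := by gcongr; exact le_max_right _ _
        _ ≤ max 1 ‖P‖ ^ (1 : ℝ) := Real.rpow_le_rpow_of_exponent_le (le_max_left _ _) ht.2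
        _ = _ := Real.rpow_one _

theorem IsSelfAdjointSemigroup.diagonal {a : ℝ → H →L[ℂ] H} (ha : IsSelfAdjointSemigroup a)
    (d : ℕ) : IsSelfAdjointSemigroup fun t => SphericalTransforms.diagonal d (a t) where
  zero := by rw [ha.zero, diagonal_one]
  add hs ht := by rw [ha.add hs ht, diagonal_mul]
  isSelfAdjoint t := isSelfAdjoint_diagonal (ha.isSelfAdjoint t)
  bounded := ha.bounded.imp fun _ hM t ht => (norm_diagonal_le _).trans (hM t ht)

/-! ### Norm bounds for the spherical transforms. -/

theorem norm_modulus (T : Fin d → H →L[ℂ] H) : ‖modulus T‖ = sphericalNorm T := by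
  have h : (fun x : H => √(∑ k, ‖T k x‖ ^ 2)) = fun x => ‖modulus T x‖ := by
    ext x
    rw [← norm_modulus_apply_sq, Real.sqrt_sq (norm_nonneg _)]
  rw [sphericalNorm, h, sSup_sphere_eq_norm]

theorem norm_column_polarPart_le (T : Fin d → H →L[ℂ] H) : ‖column (polarPart T)‖ ≤ 1 := by
  refine opNorm_le_bound _ zero_le_one fun x => ?_
  have h := inner_sum_adjoint_mul (polarPart T) x x
  rw [(isSphericalPolar_polarPart T).sum_eq] at h
  simp only [inner_self_eq_norm_sq_to_K] at h
  have h2 : ((‖column (polarPart T) x‖ ^ 2 : ℝ) : ℂ)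
      = ⟪x, (jointKer T)ᗮ.starProjection x⟫_ℂ := by
    rw [h, norm_sq_eq]
    push_cast
    rfl
  have h3 : ‖column (polarPart T) x‖ ^ 2 ≤ ‖x‖ * ‖x‖ := by
    have := norm_inner_le_norm (𝕜 := ℂ) x ((jointKer T)ᗮ.starProjection x)
    rw [← h2, Complex.norm_real, Real.norm_of_nonneg (sq_nonneg _)] at this
    refine this.trans ?_
    gcongr
    exact Submodule.norm_starProjection_apply_le _ x
  nlinarith [norm_nonneg x, norm_nonneg (column (polarPart T) x)]

theorem column_genAluthge (T : Fin d → H →L[ℂ] H) (t : ℝ) :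
    column (genAluthge T t) = diagonal (H := H) d (modulus T ^ t) ∘L column (polarPart T) ∘L
      (modulus T ^ (1 - t)) :=
  column_mul_mul _ _ _

/-- The exponent `1` is kept so that the right side has the form `a 1 ∘L X` of the interpolation
inequality; `column_eq_polarPart_comp` likewise provides `X ∘L b 1`. -/
theorem column_duggal (T : Fin d → H →L[ℂ] H) :
    column (duggal T) = diagonal (H := H) d (modulus T ^ (1 : ℝ)) ∘L column (polarPart T) := by
  rw [CFC.rpow_one _ (modulus_nonneg T)]
  ext; simp [duggal]

theorem column_eq_polarPart_comp (T : Fin d → H →L[ℂ] H) :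
    column T = column (polarPart T) ∘L (modulus T ^ (1 : ℝ)) := by
  rw [CFC.rpow_one _ (modulus_nonneg T)]
  ext x i
  exact DFunLike.congr_fun ((isSphericalPolar_polarPart T).eq_mul i) x

theorem sphericalNorm_duggal_le (T : Fin d → H →L[ℂ] H) :
    sphericalNorm (duggal T) ≤ sphericalNorm T := by
  rw [← norm_column, column_duggal, CFC.rpow_one _ (modulus_nonneg T), ← norm_modulus T]
  refine (opNorm_comp_le _ _).trans ?_
  calc _ ≤ ‖modulus T‖ * 1 := by
        gcongr
        · exact norm_diagonal_le _
        · exact norm_column_polarPart_le T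
    _ = _ := mul_one _

theorem sphericalNorm_genAluthge_le (T : Fin d → H →L[ℂ] H) {t : ℝ} (ht : t ∈ Icc (0 : ℝ) 1) :
    sphericalNorm (genAluthge T t)
      ≤ sphericalNorm (duggal T) ^ t * sphericalNorm T ^ (1 - t) := by
  have hP := isSelfAdjointSemigroup_rpow (modulus_nonneg T)
  rw [← norm_column, ← norm_column, ← norm_column, column_genAluthge, column_duggal,
    column_eq_polarPart_comp T]
  exact (hP.diagonal d).norm_comp_le_rpow_mul_rpow hP _ ht

theorem sphericalNorm_aluthge_le_heinz (T : Fin d → H →L[ℂ] H) {t : ℝ}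
    (ht : t ∈ Icc (0 : ℝ) 1) : sphericalNorm (aluthge T) ≤ sphericalNorm (heinz T t) := by
  have hP := isSelfAdjointSemigroup_rpow (modulus_nonneg T)
  have h := (hP.diagonal d).two_mul_norm_comp_half_le hP (column (polarPart T)) ht
  have e : column (aluthge T) = diagonal (H := H) d (modulus T ^ (1 / 2 : ℝ)) ∘L
      column (polarPart T) ∘L (modulus T ^ (1 / 2 : ℝ)) := column_mul_mul _ _ _
  rw [← norm_column, ← norm_column, heinz, column_smul, column_add, column_genAluthge,
    column_genAluthge, sub_sub_cancel, norm_smul, e]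
  norm_num
  norm_num at h
  linarith

theorem sphericalNorm_heinz_le (T : Fin d → H →L[ℂ] H) {t : ℝ} (ht : t ∈ Icc (0 : ℝ) 1) :
    sphericalNorm (heinz T t)
      ≤ (1 / 2 : ℝ) * (sphericalNorm (duggal T) ^ t * sphericalNorm T ^ (1 - t)
        + sphericalNorm (duggal T) ^ (1 - t) * sphericalNorm T ^ t) := by
  have h1 := sphericalNorm_genAluthge_le T ht
  have h2 := sphericalNorm_genAluthge_le T (t := 1 - t) ⟨by linarith [ht.2], by linarith [ht.1]⟩
  rw [sub_sub_cancel] at h2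
  rw [← norm_column (heinz T t), heinz, column_smul, column_add, norm_smul,
    show ‖(1 / 2 : ℂ)‖ = 1 / 2 by norm_num]
  rw [← norm_column (genAluthge T _)] at h1 h2
  gcongr
  exact (norm_add_le _ _).trans (add_le_add h1 h2)

end

end SphericalTransforms

theorem theorem2p2 {H : Type*} [NormedAddCommGroup H] [InnerProductSpace ℂ H] [CompleteSpace H]
    [TopologicalSpace.SeparableSpace H] {d : ℕ} (T : Fin d → H →L[ℂ] H)
    (t : ℝ) (ht : t ∈ Set.Icc (0 : ℝ) 1) :
    (SphericalTransforms.sphericalNorm (SphericalTransforms.aluthge T)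
        ≤ SphericalTransforms.sphericalNorm (SphericalTransforms.heinz T t) ∧
      SphericalTransforms.sphericalNorm (SphericalTransforms.heinz T t)
        ≤ (1 / 2 : ℝ) *
          (SphericalTransforms.sphericalNorm (SphericalTransforms.duggal T) ^ t
              * SphericalTransforms.sphericalNorm T ^ (1 - t)
            + SphericalTransforms.sphericalNorm (SphericalTransforms.duggal T) ^ (1 - t)
              * SphericalTransforms.sphericalNorm T ^ t) ∧
      (1 / 2 : ℝ) *
          (SphericalTransforms.sphericalNorm (SphericalTransforms.duggal T) ^ t
              * SphericalTransforms.sphericalNorm T ^ (1 - t)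
            + SphericalTransforms.sphericalNorm (SphericalTransforms.duggal T) ^ (1 - t)
              * SphericalTransforms.sphericalNorm T ^ t)
        ≤ SphericalTransforms.sphericalNorm T) ∧
    (SphericalTransforms.sphericalNorm (SphericalTransforms.aluthge T)
        ≤ SphericalTransforms.sphericalNorm (SphericalTransforms.heinz T t) ∧
      SphericalTransforms.sphericalNorm (SphericalTransforms.heinz T t)
        ≤ (1 / 2 : ℝ) *
          (SphericalTransforms.sphericalNorm (SphericalTransforms.duggal T)
            + SphericalTransforms.sphericalNorm T) ∧
      (1 / 2 : ℝ) *
          (SphericalTransforms.sphericalNorm (SphericalTransforms.duggal T)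
            + SphericalTransforms.sphericalNorm T)
        ≤ SphericalTransforms.sphericalNorm T) := by
  have hA := SphericalTransforms.sphericalNorm_aluthge_le_heinz T ht
  have hB := SphericalTransforms.sphericalNorm_heinz_le T ht
  have hD := SphericalTransforms.sphericalNorm_duggal_le T
  have hD0 := SphericalTransforms.sphericalNorm_nonneg (SphericalTransforms.duggal T)
  have hT0 := SphericalTransforms.sphericalNorm_nonneg T
  have ht' : 0 ≤ 1 - t := by linarith [ht.2]
  -- The weights `(t, 1 - t)` and `(1 - t, t)` are complementary, so the two arithmetic means sum to
  -- `‖T^D‖ + ‖T‖`.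
  have m1 := Real.geom_mean_le_arith_mean2_weighted ht.1 ht' hD0 hT0 (by ring)
  have m2 := Real.geom_mean_le_arith_mean2_weighted ht' ht.1 hD0 hT0 (by ring)
  have hC : (1 / 2 : ℝ) *
      (SphericalTransforms.sphericalNorm (SphericalTransforms.duggal T) ^ t
          * SphericalTransforms.sphericalNorm T ^ (1 - t)
        + SphericalTransforms.sphericalNorm (SphericalTransforms.duggal T) ^ (1 - t)
          * SphericalTransforms.sphericalNorm T ^ t)
      ≤ (1 / 2 : ℝ) * (SphericalTransforms.sphericalNorm (SphericalTransforms.duggal T)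
        + SphericalTransforms.sphericalNorm T) := by
    linarith
  have hE : (1 / 2 : ℝ) * (SphericalTransforms.sphericalNorm (SphericalTransforms.duggal T)
        + SphericalTransforms.sphericalNorm T) ≤ SphericalTransforms.sphericalNorm T := by
    linarith
  exact ⟨⟨hA, hB, hC.trans hE⟩, hA, hB.trans hC, hE⟩
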